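/- **Proposition (Maitre nonlinear compactness).** Let $T>0$ and let either $1\le p<\infty$, $r=1$, or $p=\infty$, $1<r\le\infty$. Let $X$, $B$ be Banach spaces and let $K:X\to B$ be a (possibly nonlinear) compact operator, i.e. $K$ maps bounded subsets of $X$ to relatively compact subsets of $B$. Let $(\tau_n)_{n\in\mathbb N}$ be a sequence of time steps $\tau_n>0$ with $T=N_n\tau_n$, $N_n\in\mathbb N$, and let $v_n\in L^1(0,T;X)$ be constant on each interval $((k-1)\tau_n,k\tau_n]$, $1\le k\le N_n$. Let $u_n=K(v_n)\in L^p(0,T;B)$. Assume that (i) $(v_n)$ is bounded in $L^1(0,T;X)$ and $(u_n)$ is bounded in $L^1(0,T;B)$; (ii) there exists $C>0$ such that for all $n$, $\|u_n(\cdot+\tau_n)-u_n\|_{L^r(0,T-\tau_n;B)}\le C\tau_n$. Then, if $p<\infty$, $(u_n)$ is relatively compact in $L^p(0,T;B)$. If $p=\infty$ and $\tau_n\to0$ as $n\to\infty$, there exist a subsequence of $(u_n)$ and a function $u\in C^0([0,T];B)$ such that this subsequence converges to $u$ in $L^q(0,T;B)$ for all $1\le q<\infty$. -/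

import Mathlib

open MeasureTheory Filter Topology Set
open scoped ENNReal

/-- A (possibly nonlinear) compact operator: the image of every bounded set is relatively
compact. Linearity is not required, nor is continuity. -/
def IsNonlinearCompact {X B : Type*} [NormedAddCommGroup X] [NormedAddCommGroup B]
    (K : X → B) : Prop :=
  ∀ S : Set X, Bornology.IsBounded S → IsCompact (closure (K '' S))

/-- `f` is constant on each of the intervals `((k - 1) * τ, k * τ]`, `1 ≤ k ≤ N`. -/
def IsPiecewiseConstInTime {E : Type*} (τ : ℝ) (N : ℕ) (f : ℝ → E) : Prop :=
  ∀ k : ℕ, 1 ≤ k → k ≤ N →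
    ∃ c : E, ∀ t ∈ Ioc (((k : ℝ) - 1) * τ) ((k : ℝ) * τ), f t = c

/-- Lebesgue measure on the open interval `(a, b)`. -/
noncomputable def timeMeasure (a b : ℝ) : Measure ℝ := volume.restrict (Ioo a b)

/-!
Up to the factor `τ n`, the `L¹` norm of `u_n(· + τ_n) - u_n` is the sum of the jumps of `u_n`, so
the shift estimate bounds the total variation of `u_n`; for `r > 1`, Hölder's inequality even bounds
the variation on an interval of length `h` by `C h ^ (1 - 1 / r)`. On the other hand, the mean of
`‖v_n‖` over a fixed time interval is bounded, so within every interval each `u_n` takes a value in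
one relatively compact set. Choosing such values on a fine grid, finitely many patterns of values
suffice up to a small error. Between the chosen times two functions with neighbouring patterns
drift apart by at most their variation: in `L^p` this costs the total variation times the `1 / p`-th
power of the mesh, while for `r > 1` and `τ_n → 0` it is uniformly small, which is the setting of
the Arzelà-Ascoli theorem up to an error that vanishes with `τ_n`.
-/

open scoped Uniformity

section TotallyBounded

variable {ι α E : Type*}

lemma totallyBounded_univ_pi {κ : Type*} {B : κ → Type*} [∀ k, UniformSpace (B k)]
    {A : ∀ k, Set (B k)} (hA : ∀ k, TotallyBounded (A k)) : TotallyBounded (univ.pi A) := by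
  refine totallyBounded_iff_ultrafilter.2 fun F hF => (cauchy_pi_iff' B).2 fun k => ?_
  refine totallyBounded_iff_ultrafilter.1 (hA k) (F.map (Function.eval k)) ?_
  exact (tendsto_principal_principal.2 fun _ ha => mem_univ_pi.1 ha k).mono_left hF

lemma totallyBounded_range_iff [PseudoEMetricSpace E] {f : ι → E} :
    TotallyBounded (range f) ↔
      ∀ ε > 0, ∃ I : Set ι, I.Finite ∧ ∀ i, ∃ j ∈ I, edist (f i) (f j) < ε := by
  rw [EMetric.totallyBounded_iff', ← image_univ]
  refine forall₂_congr fun ε _ => exists_subset_image_finite_and.trans ?_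
  simp [subset_def]

/-- The family `f` visits `s` above a totally bounded set: some totally bounded `A` contains a
value of every `f i` on `s`. This is all the compactness which a bound in mean gives to `u_n`: the
visiting times depend on `i`. -/
def MeetsTotallyBounded [UniformSpace E] (s : Set α) (f : ι → α → E) : Prop :=
  ∃ A : Set E, TotallyBounded A ∧ ∀ i, ∃ x ∈ s, f i x ∈ A

lemma MeetsTotallyBounded.comp_left {κ : Type*} [UniformSpace E] {s : Set α} {f : ι → α → E}
    (h : MeetsTotallyBounded s f) (g : κ → ι) : MeetsTotallyBounded s fun k => f (g k) :=
  h.imp fun _ hA => ⟨hA.1, fun k => hA.2 (g k)⟩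

lemma MeetsTotallyBounded.exists_finite_forall_edist_lt {κ : Type*} [Finite κ]
    [PseudoEMetricSpace E] {f : ι → α → E} {s : κ → Set α}
    (h : ∀ k, MeetsTotallyBounded (s k) f) {δ : ℝ≥0∞} (hδ : 0 < δ) :
    ∃ I : Set ι, I.Finite ∧ ∀ i, ∃ j ∈ I, ∀ k, ∃ x ∈ s k, ∃ y ∈ s k,
      edist (f i x) (f j y) < δ := by
  have := Fintype.ofFinite κ
  choose A hA x hxs hxA using h
  have hpattern : TotallyBounded (range fun i k => f i (x k i)) :=
    (totallyBounded_univ_pi hA).subset (range_subset_iff.2 fun i => mem_univ_pi.2 (hxA · i))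
  obtain ⟨I, hI, hIδ⟩ := totallyBounded_range_iff.1 hpattern δ hδ
  refine ⟨I, hI, fun i => ?_⟩
  obtain ⟨j, hj, hij⟩ := hIδ i
  exact ⟨j, hj, fun k => ⟨x k i, hxs k i, x k j, hxs k j, (edist_le_pi_edist _ _ k).trans_lt hij⟩⟩

end TotallyBounded

section BoundedVariation

lemma eLpNorm_restrict_biUnion_le_sum {ι α F : Type*} [MeasurableSpace α] [NormedAddCommGroup F]
    {μ : Measure α} {p : ℝ≥0∞} (hp : 1 ≤ p) {f : α → F} (I : Finset ι) {s : ι → Set α}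
    (hs : ∀ i ∈ I, MeasurableSet (s i)) {W : ι → ℝ≥0∞} (hW : ∀ i ∈ I, ∀ x ∈ s i, ‖f x‖ₑ ≤ W i) :
    eLpNorm f p (μ.restrict (⋃ i ∈ I, s i)) ≤ ∑ i ∈ I, W i * μ (s i) ^ (1 / p.toReal) := by
  set g : α → ℝ≥0∞ := ∑ i ∈ I, (s i).indicator fun _ => W i with hg
  have hfg : ∀ x, ‖(⋃ i ∈ I, s i).indicator f x‖ₑ ≤ ‖g x‖ₑ := fun x => by
    rw [enorm_indicator_eq_indicator_enorm]
    refine indicator_le (fun x hx => ?_) x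
    obtain ⟨i, hi, hxi⟩ := mem_iUnion₂.1 hx
    calc ‖f x‖ₑ ≤ (s i).indicator (fun _ => W i) x := by
          rw [indicator_of_mem hxi]; exact hW i hi x hxi
      _ ≤ ‖g x‖ₑ := by
          rw [hg, Finset.sum_apply]
          exact Finset.single_le_sum (f := fun i => (s i).indicator (fun _ => W i) x)
            (fun _ _ => zero_le) hi
  calc eLpNorm f p (μ.restrict (⋃ i ∈ I, s i))
      = eLpNorm ((⋃ i ∈ I, s i).indicator f) p μ :=
        (eLpNorm_indicator_eq_eLpNorm_restrict (I.measurableSet_biUnion hs)).symm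
    _ ≤ eLpNorm g p μ := eLpNorm_mono_enorm hfg
    _ ≤ ∑ i ∈ I, eLpNorm ((s i).indicator fun _ => W i) p μ :=
        eLpNorm_sum_le (fun i hi => aestronglyMeasurable_const.indicator (hs i hi)) hp
    _ ≤ ∑ i ∈ I, W i * μ (s i) ^ (1 / p.toReal) :=
        Finset.sum_le_sum fun i _ => eLpNorm_indicator_const_le (W i) p

lemma sum_eVariationOn_Ioc_le {α E : Type*} [LinearOrder α] [PseudoEMetricSpace E] (f : α → E)
    {x : ℕ → α} (hx : Monotone x) (n : ℕ) :
    ∑ k ∈ Finset.range n, eVariationOn f (Ioc (x k) (x (k + 1))) ≤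
      eVariationOn f (Ioc (x 0) (x n)) := by
  induction n with
  | zero => simp
  | succ n ih =>
    rw [Finset.sum_range_succ, ← Ioc_union_Ioc_eq_Ioc (hx n.zero_le) (hx n.le_succ)]
    exact (add_le_add_left ih _).trans
      (eVariationOn.add_le_union f fun _ ha _ hb => ha.2.trans hb.1.le)

lemma edist_le_eVariationOn_add {α E : Type*} [LinearOrder α] [PseudoEMetricSpace E] {f g : α → E}
    {s : Set α} {δ : ℝ≥0∞} (hfg : ∃ x ∈ s, ∃ y ∈ s, edist (f x) (g y) < δ) {t : α} (ht : t ∈ s) :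
    edist (f t) (g t) ≤ eVariationOn f s + δ + eVariationOn g s := by
  obtain ⟨x, hx, y, hy, hxy⟩ := hfg
  calc edist (f t) (g t) ≤ edist (f t) (f x) + edist (f x) (g y) + edist (g y) (g t) :=
        edist_triangle4 _ _ _ _
    _ ≤ eVariationOn f s + δ + eVariationOn g s := by
        gcongr
        exacts [eVariationOn.edist_le f ht hx, eVariationOn.edist_le g hy ht]

lemma eLpNorm_sub_Ioc_le_eVariationOn {α F : Type*} [LinearOrder α] [TopologicalSpace α]
    [OrderClosedTopology α] [MeasurableSpace α] [OpensMeasurableSpace α] [NormedAddCommGroup F]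
    {μ : Measure α} {p : ℝ≥0∞} (hp : 1 ≤ p) {f g : α → F} {x : ℕ → α} (hx : Monotone x) {n : ℕ}
    {m δ : ℝ≥0∞} (hμ : ∀ k < n, μ (Ioc (x k) (x (k + 1))) ≤ m)
    (hfg : ∀ k < n, ∃ a ∈ Ioc (x k) (x (k + 1)), ∃ b ∈ Ioc (x k) (x (k + 1)),
      edist (f a) (g b) < δ) :
    eLpNorm (f - g) p (μ.restrict (Ioc (x 0) (x n))) ≤
      (eVariationOn f (Ioc (x 0) (x n)) + n * δ + eVariationOn g (Ioc (x 0) (x n))) *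
        m ^ (1 / p.toReal) := by
  have hcover : ⋃ k ∈ Finset.range n, Ioc (x k) (x (k + 1)) = Ioc (x 0) (x n) := by
    simpa using hx.biUnion_Ico_Ioc_map_succ 0 n
  set V : (α → F) → ℕ → ℝ≥0∞ := fun h k => eVariationOn h (Ioc (x k) (x (k + 1)))
  calc eLpNorm (f - g) p (μ.restrict (Ioc (x 0) (x n)))
      ≤ ∑ k ∈ Finset.range n,
          (V f k + δ + V g k) * μ (Ioc (x k) (x (k + 1))) ^ (1 / p.toReal) := by
        rw [← hcover]
        refine eLpNorm_restrict_biUnion_le_sum hp _ (fun _ _ => measurableSet_Ioc)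
          fun k hk t ht => ?_
        rw [Pi.sub_apply, ← edist_eq_enorm_sub]
        exact edist_le_eVariationOn_add (hfg k (Finset.mem_range.1 hk)) ht
    _ ≤ ∑ k ∈ Finset.range n, (V f k + δ + V g k) * m ^ (1 / p.toReal) := by
        gcongr with k hk
        exact hμ k (Finset.mem_range.1 hk)
    _ = (∑ k ∈ Finset.range n, V f k + n * δ + ∑ k ∈ Finset.range n, V g k) *
          m ^ (1 / p.toReal) := by
        simp only [← Finset.sum_mul, Finset.sum_add_distrib, Finset.sum_const, Finset.card_range,
          nsmul_eq_mul]
    _ ≤ _ := by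
        gcongr
        exacts [sum_eVariationOn_Ioc_le f hx n, sum_eVariationOn_Ioc_le g hx n]

end BoundedVariation

lemma timeMeasure_eq_restrict_Ioc (a b : ℝ) : timeMeasure a b = volume.restrict (Ioc a b) :=
  Measure.restrict_congr_set Ioo_ae_eq_Ioc

lemma tendsto_const_mul_ofReal_rpow_zero {β : Type*} {l : Filter β} {x : β → ℝ}
    (hx : Tendsto x l (𝓝 0)) {C : ℝ≥0∞} (hC : C ≠ ∞) {e : ℝ} (he : 0 < e) :
    Tendsto (fun b => C * ENNReal.ofReal (x b) ^ e) l (𝓝 0) := by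
  have hx' : Tendsto (fun b => ENNReal.ofReal (x b)) l (𝓝 0) := by
    simpa using ENNReal.tendsto_ofReal hx
  simpa [he] using ENNReal.Tendsto.const_mul
    ((ENNReal.continuous_rpow_const (y := e)).tendsto 0 |>.comp hx') (.inr hC)

theorem totallyBounded_range_toLp_of_eVariationOn_le {ι F : Type*} [NormedAddCommGroup F]
    {p : ℝ≥0∞} [Fact (1 ≤ p)] (hp : p ≠ ∞) {a b : ℝ} (hab : a < b) {u : ι → ℝ → F}
    (hu : ∀ i, MemLp (u i) p (timeMeasure a b)) {C : ℝ≥0∞} (hC : C ≠ ∞)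
    (hvar : ∀ i, eVariationOn (u i) (Ioc a b) ≤ C)
    (hmeet : ∀ s t, a ≤ s → s < t → t ≤ b → MeetsTotallyBounded (Ioc s t) u) :
    TotallyBounded (range fun i => (hu i).toLp (u i)) := by
  refine totallyBounded_range_iff.2 fun ε hε => ?_
  have hp0 : 0 < 1 / p.toReal :=
    one_div_pos.2 (ENNReal.toReal_pos (zero_lt_one.trans_le Fact.out).ne' hp)
  have hC' : C + 1 + C ≠ ∞ := by finiteness
  have hlim := tendsto_const_mul_ofReal_rpow_zero
    (tendsto_const_div_atTop_nhds_zero_nat (b - a)) hC' hp0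
  obtain ⟨M, hMε, hM⟩ := ((hlim.eventually_lt_const hε).and (eventually_gt_atTop 0)).exists
  have hh : 0 < (b - a) / M := div_pos (sub_pos.2 hab) (Nat.cast_pos.2 hM)
  set x : ℕ → ℝ := fun k => a + k * ((b - a) / M) with hx
  have hxM : x M = b := by simp [hx, field]
  have hx0 : x 0 = a := by simp [hx]
  have hxs : StrictMono x :=
    fun i j hij => add_lt_add_right (mul_lt_mul_of_pos_right (Nat.cast_lt.2 hij) hh) a
  have hcell : ∀ k, x (k + 1) - x k = (b - a) / M := fun k => by simp [hx, add_mul]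
  obtain ⟨I, hI, hIδ⟩ := MeetsTotallyBounded.exists_finite_forall_edist_lt
    (s := fun k : Fin M => Ioc (x k) (x (k + 1)))
    (fun k => hmeet _ _ (hx0 ▸ hxs.monotone k.val.zero_le) (hxs k.val.lt_succ_self)
      (hxM ▸ hxs.monotone k.isLt)) (ENNReal.inv_pos.2 (ENNReal.natCast_ne_top M))
  refine ⟨I, hI, fun i => ?_⟩
  obtain ⟨j, hj, hij⟩ := hIδ i
  refine ⟨j, hj, lt_of_le_of_lt ?_ hMε⟩
  have hdist := eLpNorm_sub_Ioc_le_eVariationOn (p := p) Fact.out hxs.monotone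
    (fun k _ => (Real.volume_Ioc.trans (congrArg _ (hcell k))).le) fun k hk => hij ⟨k, hk⟩
  rw [hx0, hxM, ← timeMeasure_eq_restrict_Ioc] at hdist
  rw [Lp.edist_toLp_toLp]
  refine hdist.trans ?_
  gcongr
  exacts [hvar i, ENNReal.mul_inv_le_one _, hvar j]

section AsymptoticEquicontinuity

variable {ι α E : Type*}

/-- The members of the family `f` become uniformly equicontinuous along the filter `l`: the modulus
of continuity may fail at any given `i`, but the defect vanishes in the limit. Step functions with
vanishing step size can have this property, although none of them is continuous. -/
def AsymptoticallyUniformEquicontinuous [UniformSpace α] [UniformSpace E] (f : ι → α → E)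
    (l : Filter ι) : Prop :=
  Tendsto (fun q : ι × α × α => (f q.1 q.2.1, f q.1 q.2.2)) (l ×ˢ 𝓤 α) (𝓤 E)

namespace AsymptoticallyUniformEquicontinuous

lemma exists_entourage [UniformSpace α] [UniformSpace E] {f : ι → α → E} {l : Filter ι}
    (hf : AsymptoticallyUniformEquicontinuous f l) {V : Set (E × E)} (hV : V ∈ 𝓤 E) :
    ∃ U ∈ 𝓤 α, ∀ᶠ i in l, ∀ x y, (x, y) ∈ U → (f i x, f i y) ∈ V := by
  obtain ⟨P, hP, Q, hQ, hPQ⟩ := eventually_prod_iff.1 (hf hV)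
  exact ⟨{q | Q q}, hQ, hP.mono fun i hi x y hxy => hPQ hi hxy⟩

lemma uniformContinuous_of_tendsto [UniformSpace α] [UniformSpace E] {f : ι → α → E}
    {l : Filter ι} [l.NeBot] (hf : AsymptoticallyUniformEquicontinuous f l) {w : α → E}
    (hw : ∀ x, Tendsto (f · x) l (𝓝 (w x))) : UniformContinuous w := by
  refine uniformity_hasBasis_closed.tendsto_right_iff.2 fun V ⟨hV, hVclosed⟩ => ?_
  obtain ⟨U, hU, hUV⟩ := hf.exists_entourage hV
  filter_upwards [hU] with ⟨x, y⟩ hxy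
  exact hVclosed.mem_of_tendsto ((hw x).prodMk_nhds (hw y)) (hUV.mono fun i hi => hi x y hxy)

theorem totallyBounded_range_ofFun [UniformSpace α] [PseudoEMetricSpace E] {f : ι → α → E}
    (hf : AsymptoticallyUniformEquicontinuous f cofinite)
    (hα : TotallyBounded (univ : Set α))
    (hmeet : ∀ x, ∀ V ∈ 𝓝 x, MeetsTotallyBounded V f) :
    TotallyBounded (range fun i => UniformFun.ofFun (f i)) := by
  refine totallyBounded_range_iff.2 fun ε hε => ?_
  obtain ⟨ε', hε', hε'ε⟩ := exists_between hε
  obtain ⟨δ, hδ, hδε⟩ : ∃ δ : ℝ≥0∞, 0 < δ ∧ δ + δ + δ < ε :=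
    ⟨ε' / 3, ENNReal.div_pos hε'.ne' (by finiteness), (ENNReal.add_thirds ε').trans_lt hε'ε⟩
  obtain ⟨U, hU, hUδ⟩ := hf.exists_entourage (edist_mem_uniformity hδ)
  obtain ⟨U', hU', _, hcomp⟩ := comp_symm_mem_uniformity_sets hU
  obtain ⟨S, hS, hcover⟩ := hα U' hU'
  set good := {i | ∀ x y, (x, y) ∈ U → edist (f i x) (f i y) < δ}
  have := hS.to_subtype
  obtain ⟨I, hI, hIδ⟩ := MeetsTotallyBounded.exists_finite_forall_edist_lt
    (f := fun i : good => f i) (s := fun y : S => {x | (x, (y : α)) ∈ U'})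
    (fun y => (hmeet y _ (mem_nhds_right _ hU')).comp_left _) hδ
  refine ⟨goodᶜ ∪ Subtype.val '' I, (mem_cofinite.1 hUδ).union (hI.image _), fun i => ?_⟩
  by_cases hi : i ∈ good
  · obtain ⟨j, hj, hij⟩ := hIδ ⟨i, hi⟩
    refine ⟨j, .inr (mem_image_of_mem _ hj), (UniformFun.edist_le.2 fun x => ?_).trans_lt hδε⟩
    obtain ⟨y, hy, hxy⟩ := mem_iUnion₂.1 (hcover (mem_univ x))
    obtain ⟨a, ha, b, hb, hab⟩ := hij ⟨y, hy⟩
    have hU_of : ∀ {c d}, (c, y) ∈ U' → (d, y) ∈ U' → (c, d) ∈ U :=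
      fun hc hd => hcomp ⟨y, hc, SetRel.symm U' hd⟩
    calc edist (f i x) (f j x) ≤ edist (f i x) (f i a) + edist (f i a) (f j b) +
          edist (f j b) (f j x) := edist_triangle4 _ _ _ _
      _ ≤ δ + δ + δ := by
        gcongr
        exacts [(hi _ _ (hU_of hxy ha)).le, (j.2 _ _ (hU_of hb hxy)).le]
  · exact ⟨i, .inl hi, by rwa [edist_self]⟩

theorem exists_subseq_tendstoUniformly [UniformSpace α] [PseudoEMetricSpace E] [CompleteSpace E]
    {f : ℕ → α → E} (hf : AsymptoticallyUniformEquicontinuous f atTop)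
    (hα : TotallyBounded (univ : Set α))
    (hmeet : ∀ x, ∀ V ∈ 𝓝 x, MeetsTotallyBounded V f) :
    ∃ φ : ℕ → ℕ, StrictMono φ ∧ ∃ w, UniformContinuous w ∧
      TendstoUniformly (fun n => f (φ n)) w atTop := by
  have htb := totallyBounded_range_ofFun (Nat.cofinite_eq_atTop ▸ hf) hα hmeet
  obtain ⟨w, -, φ, hφ, hw⟩ := (htb.closure.isCompact_of_isClosed isClosed_closure).tendsto_subseq
    fun n => subset_closure (mem_range_self n)
  rw [UniformFun.tendsto_iff_tendstoUniformly] at hw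
  have hfφ : AsymptoticallyUniformEquicontinuous (fun n => f (φ n)) atTop :=
    hf.comp (hφ.tendsto_atTop.prodMap tendsto_id)
  exact ⟨φ, hφ, _, hfφ.uniformContinuous_of_tendsto fun x => hw.tendsto_at x, hw⟩

end AsymptoticallyUniformEquicontinuous

end AsymptoticEquicontinuity

lemma tendsto_eLpNorm_of_tendstoUniformlyOn_Ioc {ι F : Type*} [NormedAddCommGroup F] {a b : ℝ}
    {l : Filter ι} {f : ι → ℝ → F} {w : ℝ → F} (h : TendstoUniformlyOn f w l (Ioc a b))
    (q : ℝ≥0∞) :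
    Tendsto (fun i => eLpNorm (fun t => f i t - w t) q (timeMeasure a b)) l (𝓝 0) := by
  rw [timeMeasure_eq_restrict_Ioc]
  set c := (volume.restrict (Ioc a b)) univ ^ q.toReal⁻¹
  have hc : c ≠ ∞ := by finiteness
  refine ENNReal.tendsto_nhds_zero.2 fun ε hε => ?_
  obtain ⟨δ, hδ, hδε⟩ := ENNReal.exists_nnreal_pos_mul_lt hc hε.ne'
  filter_upwards [EMetric.tendstoUniformlyOn_iff.1 h δ (by exact_mod_cast hδ)] with i hi
  refine (eLpNorm_le_of_ae_enorm_bound (C := δ) ?_).trans hδε.le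
  refine (ae_restrict_mem measurableSet_Ioc).mono fun t ht => ?_
  rw [← edist_eq_enorm_sub, edist_comm]
  exact (hi t ht).le

lemma IsNonlinearCompact.meetsTotallyBounded {ι X B : Type*} [NormedAddCommGroup X]
    [NormedAddCommGroup B] {K : X → B} (hK : IsNonlinearCompact K) {α : Type*} [MeasurableSpace α]
    {μ : Measure α} {s : Set α} (hμ0 : μ s ≠ 0) (hμ : μ s ≠ ∞) {v : ι → α → X}
    (hv : ∀ i, AEStronglyMeasurable (v i) (μ.restrict s)) {C : ℝ≥0∞} (hC : C ≠ ∞)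
    (hvC : ∀ i, eLpNorm (v i) 1 (μ.restrict s) ≤ C) :
    MeetsTotallyBounded s fun i t => K (v i t) := by
  have hR : C / μ s ≠ ∞ := ENNReal.div_ne_top hC hμ0
  refine ⟨K '' Metric.closedBall 0 (C / μ s).toReal, ?_, fun i => ?_⟩
  · exact (hK _ Metric.isBounded_closedBall).totallyBounded.subset subset_closure
  · obtain ⟨t, ht, hvt⟩ := exists_le_setLAverage hμ0 hμ (hv i).enorm
    refine ⟨t, ht, mem_image_of_mem K ?_⟩
    rw [mem_closedBall_zero_iff, ← toReal_enorm]
    refine ENNReal.toReal_mono hR (hvt.trans ?_)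
    rw [setLAverage_eq, ← eLpNorm_one_eq_lintegral_enorm]
    gcongr
    exact hvC i

section PiecewiseConst

lemma one_sub_one_div_toReal_nonneg {r : ℝ≥0∞} (hr : 1 ≤ r) : 0 ≤ 1 - 1 / r.toReal := by
  rcases eq_or_ne r ∞ with rfl | hr'
  · simp
  · have : 1 ≤ r.toReal := by simpa using ENNReal.toReal_mono hr' hr
    exact sub_nonneg.2 (div_le_one_of_le₀ this (by positivity))

variable {E F : Type*} {τ : ℝ} {N : ℕ}

namespace IsPiecewiseConstInTime

lemma comp {f : ℝ → E} (hf : IsPiecewiseConstInTime τ N f) (g : E → F) :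
    IsPiecewiseConstInTime τ N fun t => g (f t) := fun k hk hkN =>
  (hf k hk hkN).imp' g fun _ hc t ht => congrArg g (hc t ht)

lemma congr {f g : ℝ → E} (hf : IsPiecewiseConstInTime τ N f) (hτ : 0 ≤ τ)
    (hfg : EqOn f g (Ioc 0 (N * τ))) : IsPiecewiseConstInTime τ N g := fun k hk hkN =>
  (hf k hk hkN).imp fun _ hc t ht => by
    have hk' : (1 : ℝ) ≤ k := mod_cast hk
    rw [← hc t ht, hfg ⟨?_, ?_⟩]
    · exact (mul_nonneg (sub_nonneg.2 hk') hτ).trans_lt ht.1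
    · exact ht.2.trans (by gcongr)

lemma eq_ceil {f : ℝ → E} (hf : IsPiecewiseConstInTime τ N f) (hτ : 0 < τ) {t : ℝ}
    (ht : t ∈ Ioc 0 (N * τ)) : f t = f (⌈t / τ⌉₊ * τ) := by
  have hk : 1 ≤ ⌈t / τ⌉₊ := Nat.one_le_ceil_iff.2 (div_pos ht.1 hτ)
  obtain ⟨c, hc⟩ := hf _ hk (Nat.ceil_le.2 ((div_le_iff₀ hτ).2 ht.2))
  rw [hc t ⟨?_, ?_⟩, hc _ ⟨?_, le_rfl⟩]
  · gcongr; linarith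
  · rw [← lt_div_iff₀ hτ, sub_lt_iff_lt_add]
    exact Nat.ceil_lt_add_one (div_nonneg ht.1.le hτ.le)
  · exact (div_le_iff₀ hτ).1 (Nat.le_ceil _)

lemma sub_shift [Sub E] {f : ℝ → E} (hf : IsPiecewiseConstInTime τ (N + 1) f) :
    IsPiecewiseConstInTime τ N fun t => f (t + τ) - f t := fun k hk hkN => by
  obtain ⟨c, hc⟩ := hf k hk (by lia)
  obtain ⟨d, hd⟩ := hf (k + 1) (by lia) (by lia)
  refine ⟨d - c, fun t ht => ?_⟩
  change f (t + τ) - f t = d - c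
  rw [hc t ht, hd (t + τ) ⟨?_, ?_⟩]
  · push_cast; linarith [ht.1]
  · push_cast; linarith [ht.2]

lemma aestronglyMeasurable [TopologicalSpace E] [TopologicalSpace.PseudoMetrizableSpace E]
    {f : ℝ → E} (hf : IsPiecewiseConstInTime τ N f) (hτ : 0 < τ) :
    AEStronglyMeasurable f (timeMeasure 0 (N * τ)) := by
  have hmeas : StronglyMeasurable fun t : ℝ => f (⌈t / τ⌉₊ * τ) :=
    (StronglyMeasurable.of_discrete (f := fun k : ℕ => f (k * τ))).comp_measurable
      (Nat.measurable_ceil.comp (measurable_id.div_const τ))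
  rw [timeMeasure_eq_restrict_Ioc]
  exact hmeas.aestronglyMeasurable.congr <|
    (ae_restrict_mem measurableSet_Ioc).mono fun t ht => (hf.eq_ceil hτ ht).symm

lemma setLIntegral_Ioc {g : ℝ → ℝ≥0∞} (hg : IsPiecewiseConstInTime τ N g) (hτ : 0 < τ)
    {i n : ℕ} (hin : i + n ≤ N) :
    ∫⁻ t in Ioc (i * τ) ((i + n : ℕ) * τ), g t =
      ENNReal.ofReal τ * ∑ k ∈ Finset.range n, g ((i + k + 1 : ℕ) * τ) := by
  induction n with
  | zero => simp
  | succ n ih =>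
    have hcell : ∫⁻ t in Ioc ((i + n : ℕ) * τ) ((i + n + 1 : ℕ) * τ), g t =
        ENNReal.ofReal τ * g ((i + n + 1 : ℕ) * τ) := by
      obtain ⟨c, hc⟩ := hg (i + n + 1) (by lia) hin
      have hc' : ∀ t ∈ Ioc ((i + n : ℕ) * τ) ((i + n + 1 : ℕ) * τ), g t = c := fun t ht =>
        hc t (by simpa using ht)
      rw [setLIntegral_congr_fun measurableSet_Ioc hc', setLIntegral_const, Real.volume_Ioc,
        hc' _ ⟨by push_cast; linarith, le_rfl⟩, mul_comm]
      congr 2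
      push_cast; ring
    have hsplit : Ioc (i * τ) ((i + n + 1 : ℕ) * τ) =
        Ioc (i * τ) ((i + n : ℕ) * τ) ∪ Ioc ((i + n : ℕ) * τ) ((i + n + 1 : ℕ) * τ) :=
      (Ioc_union_Ioc_eq_Ioc (mul_le_mul_of_nonneg_right (Nat.cast_le.2 (by lia)) hτ.le)
        (mul_le_mul_of_nonneg_right (Nat.cast_le.2 (by lia)) hτ.le)).symm
    rw [Finset.sum_range_succ, mul_add, ← ih (by lia), ← hcell, ← add_assoc i n 1,
      hsplit, lintegral_union measurableSet_Ioc (Ioc_disjoint_Ioc_of_le le_rfl)]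

lemma eVariationOn_Ioc_le_sum [PseudoEMetricSpace E] {f : ℝ → E}
    (hf : IsPiecewiseConstInTime τ N f) (hτ : 0 < τ) {i n : ℕ} (hin : i + n + 1 ≤ N) :
    eVariationOn f (Ioc (i * τ) ((i + n + 1 : ℕ) * τ)) ≤
      ∑ k ∈ Finset.range n, edist (f ((i + k + 1 : ℕ) * τ)) (f ((i + k + 2 : ℕ) * τ)) := by
  set F : ℕ → E := fun k => f (k * τ)
  set x : ℕ → ℕ := fun k => i + k + 1
  have hx : Monotone x := fun k l hkl => by simp only [x]; lia
  have hceil : MonotoneOn (fun t : ℝ => ⌈t / τ⌉₊) (Ioc (i * τ) ((i + n + 1 : ℕ) * τ)) :=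
    fun s _ t _ hst => Nat.ceil_mono (by gcongr)
  have hmaps : MapsTo (fun t : ℝ => ⌈t / τ⌉₊) (Ioc (i * τ) ((i + n + 1 : ℕ) * τ))
      (x '' Iic n) := fun t ht => by
    have h1 : i < ⌈t / τ⌉₊ := Nat.lt_ceil.2 ((lt_div_iff₀ hτ).2 ht.1)
    have h2 : ⌈t / τ⌉₊ ≤ i + n + 1 := Nat.ceil_le.2 ((div_le_iff₀ hτ).2 ht.2)
    exact ⟨⌈t / τ⌉₊ - (i + 1), by simp only [mem_Iic]; lia, by simp only [x]; lia⟩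
  calc eVariationOn f (Ioc (i * τ) ((i + n + 1 : ℕ) * τ))
      = eVariationOn (F ∘ fun t : ℝ => ⌈t / τ⌉₊) (Ioc (i * τ) ((i + n + 1 : ℕ) * τ)) :=
        eVariationOn.congr fun t ht => hf.eq_ceil hτ
          ⟨(by positivity : (0 : ℝ) ≤ i * τ).trans_lt ht.1, ht.2.trans (by gcongr)⟩
    _ ≤ eVariationOn F (x '' Iic n) := eVariationOn.comp_le_of_monotoneOn F _ hceil hmaps
    _ = _ := eVariationOn.image_range_of_monotone F hx n

lemma ofReal_mul_eVariationOn_le_eLpNorm_shift [NormedAddCommGroup F] {f : ℝ → F}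
    (hf : IsPiecewiseConstInTime τ (N + 1) f) (hτ : 0 < τ) {i n : ℕ} (hin : i + n ≤ N) :
    ENNReal.ofReal τ * eVariationOn f (Ioc (i * τ) ((i + n + 1 : ℕ) * τ)) ≤
      eLpNorm (fun t => f (t + τ) - f t) 1
        (volume.restrict (Ioc (i * τ) ((i + n : ℕ) * τ))) := by
  rw [eLpNorm_one_eq_lintegral_enorm, (hf.sub_shift.comp (‖·‖ₑ)).setLIntegral_Ioc hτ hin]
  gcongr
  refine (hf.eVariationOn_Ioc_le_sum hτ (by lia)).trans_eq (Finset.sum_congr rfl fun k _ => ?_)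
  rw [edist_comm, edist_eq_enorm_sub]
  congr 3
  push_cast; ring

/-- For `r = ∞` the exponent is `1`, by the conventions `∞.toReal = 0` and `1 / 0 = 0`. -/
lemma eVariationOn_Ioc_le_of_eLpNorm_shift_le [NormedAddCommGroup F] {f : ℝ → F}
    (hf : IsPiecewiseConstInTime τ N f) (hτ : 0 < τ) {r C : ℝ≥0∞} (hr : 1 ≤ r)
    (hC : eLpNorm (fun t => f (t + τ) - f t) r (timeMeasure 0 (N * τ - τ)) ≤
      C * ENNReal.ofReal τ) {i j : ℕ} (hij : i ≤ j) (hjN : j ≤ N) :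
    eVariationOn f (Ioc (i * τ) (j * τ)) ≤
      C * ENNReal.ofReal ((j - i) * τ) ^ (1 - 1 / r.toReal) := by
  rcases hij.eq_or_lt with rfl | hlt
  · simp
  obtain ⟨n, rfl⟩ := Nat.exists_eq_add_of_lt hlt
  obtain ⟨N, rfl⟩ := Nat.exists_eq_add_of_le' (by lia : 1 ≤ N)
  have hτ0 : ENNReal.ofReal τ ≠ 0 := (ENNReal.ofReal_pos.2 hτ).ne'
  have hexp : 0 ≤ 1 - 1 / r.toReal := one_sub_one_div_toReal_nonneg hr
  have hT : ((N + 1 : ℕ) : ℝ) * τ - τ = N * τ := by push_cast; ring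
  rw [hT] at hC
  set J := Ioc (i * τ) ((i + n : ℕ) * τ) with hJ
  have hJT : volume.restrict J ≤ timeMeasure 0 (N * τ) := by
    rw [timeMeasure_eq_restrict_Ioc]
    refine Measure.restrict_mono (Ioc_subset_Ioc (by positivity) ?_) le_rfl
    gcongr
    lia
  rw [← ENNReal.mul_le_mul_iff_right hτ0 ENNReal.ofReal_ne_top]
  calc ENNReal.ofReal τ * eVariationOn f (Ioc (i * τ) ((i + n + 1 : ℕ) * τ))
      ≤ eLpNorm (fun t => f (t + τ) - f t) 1 (volume.restrict J) :=
        hf.ofReal_mul_eVariationOn_le_eLpNorm_shift hτ (by lia)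
    _ ≤ eLpNorm (fun t => f (t + τ) - f t) r (volume.restrict J) *
          (volume.restrict J) univ ^ (1 - 1 / r.toReal) := by
        simpa using eLpNorm_le_eLpNorm_mul_rpow_measure_univ hr
            ((hf.sub_shift.aestronglyMeasurable hτ).mono_measure hJT)
    _ ≤ C * ENNReal.ofReal τ *
          ENNReal.ofReal (((i + n + 1 : ℕ) - i) * τ) ^ (1 - 1 / r.toReal) := by
        gcongr
        · exact (eLpNorm_mono_measure _ hJT).trans hC
        · rw [Measure.restrict_apply_univ, hJ, Real.volume_Ioc]
          gcongr
          push_cast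
          linarith
    _ = _ := by ring

lemma edist_le_of_eLpNorm_shift_le [NormedAddCommGroup F] {f : ℝ → F}
    (hf : IsPiecewiseConstInTime τ N f) (hτ : 0 < τ) {r C : ℝ≥0∞} (hr : 1 ≤ r)
    (hC : eLpNorm (fun t => f (t + τ) - f t) r (timeMeasure 0 (N * τ - τ)) ≤
      C * ENNReal.ofReal τ) {s t : ℝ} (hs : s ∈ Ioc 0 (N * τ)) (ht : t ∈ Ioc 0 (N * τ)) :
    edist (f s) (f t) ≤ C * ENNReal.ofReal (dist s t + 2 * τ) ^ (1 - 1 / r.toReal) := by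
  wlog hst : s ≤ t generalizing s t
  · rw [edist_comm, dist_comm]
    exact this ht hs (le_of_not_ge hst)
  have hi : 1 ≤ ⌈s / τ⌉₊ := Nat.one_le_ceil_iff.2 (div_pos hs.1 hτ)
  have hij : ⌈s / τ⌉₊ ≤ ⌈t / τ⌉₊ := Nat.ceil_mono (by gcongr)
  have hs_lt : ((⌈s / τ⌉₊ - 1 : ℕ) : ℝ) * τ < s :=
    (lt_div_iff₀ hτ).1 (Nat.lt_ceil.1 (Nat.sub_one_lt (by lia)))
  have ht_le : t ≤ ⌈t / τ⌉₊ * τ := (div_le_iff₀ hτ).1 (Nat.le_ceil _)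
  have hvar := hf.eVariationOn_Ioc_le_of_eLpNorm_shift_le hτ hr hC
    (i := ⌈s / τ⌉₊ - 1) (j := ⌈t / τ⌉₊) (by lia) (Nat.ceil_le.2 ((div_le_iff₀ hτ).2 ht.2))
  set J := Ioc (((⌈s / τ⌉₊ - 1 : ℕ) : ℝ) * τ) (⌈t / τ⌉₊ * τ)
  have hsJ : s ∈ J := ⟨hs_lt, hst.trans ht_le⟩
  have htJ : t ∈ J := ⟨hs_lt.trans_le hst, ht_le⟩
  refine (eVariationOn.edist_le f hsJ htJ).trans (hvar.trans ?_)
  gcongr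
  · exact one_sub_one_div_toReal_nonneg hr
  · have hs_ceil : s ≤ ⌈s / τ⌉₊ * τ := (div_le_iff₀ hτ).1 (Nat.le_ceil _)
    have ht_ceil : ⌈t / τ⌉₊ * τ < t + τ := by
      rw [← lt_div_iff₀ hτ, add_div, div_self hτ.ne']
      exact Nat.ceil_lt_add_one (div_nonneg ht.1.le hτ.le)
    rw [Real.dist_eq, abs_of_nonpos (sub_nonpos.2 hst), Nat.cast_sub hi]
    push_cast
    linarith

lemma apply_max_eq {f : ℝ → E} (hf : IsPiecewiseConstInTime τ N f) (hN : 1 ≤ N) {t : ℝ}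
    (ht : 0 < t) : f (max t τ) = f t := by
  rcases le_total τ t with h | h
  · rw [max_eq_left h]
  · obtain ⟨c, hc⟩ := hf 1 le_rfl hN
    rw [max_eq_right h, hc t (by simpa using ⟨ht, h⟩), hc τ (by simpa using ht.trans_le h)]

end IsPiecewiseConstInTime

end PiecewiseConst

lemma asymptoticallyUniformEquicontinuous_of_edist_le {ι α E : Type*} [PseudoMetricSpace α]
    [PseudoEMetricSpace E] {f : ι → α → E} {l : Filter ι} {η : ι → ℝ} (hη : Tendsto η l (𝓝 0))
    {C : ℝ≥0∞} (hC : C ≠ ∞) {e : ℝ} (he : 0 < e)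
    (hf : ∀ i x y, edist (f i x) (f i y) ≤ C * ENNReal.ofReal (dist x y + η i) ^ e) :
    AsymptoticallyUniformEquicontinuous f l := by
  have hmod : Tendsto (fun q : ι × α × α => dist q.2.1 q.2.2 + η q.1) (l ×ˢ 𝓤 α) (𝓝 0) := by
    simpa using (tendsto_uniformity_iff_dist_tendsto_zero.1 tendsto_snd).add
      (hη.comp tendsto_fst)
  refine uniformity_basis_edist.tendsto_right_iff.2 fun ε hε => ?_
  filter_upwards [(tendsto_const_mul_ofReal_rpow_zero hmod hC he).eventually_lt_const hε] with q hq
  exact (hf _ _ _).trans_lt hq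

lemma MeetsTotallyBounded.of_forall_Ioc {ι E : Type*} [UniformSpace E] {T : ℝ} (hT : 0 < T)
    {u : ι → ℝ → E}
    (hmeet : ∀ s t, 0 ≤ s → s < t → t ≤ T → MeetsTotallyBounded (Ioc s t) u)
    {f : ι → Icc 0 T → E} (hfu : ∀ i (t : Icc 0 T), 0 < (t : ℝ) → f i t = u i t)
    {x : Icc 0 T} {V : Set (Icc 0 T)} (hV : V ∈ 𝓝 x) : MeetsTotallyBounded V f := by
  obtain ⟨δ, hδ, hball⟩ := Metric.mem_nhds_iff.1 hV
  have hab : max 0 (x - δ / 2) < min T (x + δ / 2) := by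
    obtain ⟨hx0, hxT⟩ := x.2
    refine max_lt (lt_min hT ?_) (lt_min ?_ ?_) <;> linarith
  obtain ⟨A, hA, hfA⟩ := hmeet _ _ (le_max_left _ _) hab (min_le_left _ _)
  refine ⟨A, hA, fun i => ?_⟩
  obtain ⟨t, ht, htA⟩ := hfA i
  rw [mem_Ioc, max_lt_iff, le_min_iff] at ht
  obtain ⟨⟨ht0, hxt⟩, htT, htx⟩ := ht
  refine ⟨⟨t, ht0.le, htT⟩, hball ?_, by rwa [hfu i _ ht0]⟩
  rw [Metric.mem_ball, Subtype.dist_eq, Real.dist_eq, abs_sub_lt_iff]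
  constructor <;> linarith

theorem exists_subseq_tendstoUniformlyOn_of_eLpNorm_shift_le {F : Type*} [NormedAddCommGroup F]
    [CompleteSpace F] {T : ℝ} (hT : 0 < T) {τ : ℕ → ℝ} {N : ℕ → ℕ} (hτ : ∀ n, 0 < τ n)
    (hN : ∀ n, T = N n * τ n) (hlim : Tendsto τ atTop (𝓝 0)) {u : ℕ → ℝ → F}
    (hu : ∀ n, IsPiecewiseConstInTime (τ n) (N n) (u n)) {r : ℝ≥0∞} (hr : 1 < r) {C : ℝ≥0∞}
    (hC : C ≠ ∞)
    (hshift : ∀ n, eLpNorm (fun t => u n (t + τ n) - u n t) r (timeMeasure 0 (T - τ n)) ≤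
      C * ENNReal.ofReal (τ n))
    (hmeet : ∀ s t, 0 ≤ s → s < t → t ≤ T → MeetsTotallyBounded (Ioc s t) u) :
    ∃ φ : ℕ → ℕ, StrictMono φ ∧ ∃ w : ℝ → F, ContinuousOn w (Icc 0 T) ∧
      TendstoUniformlyOn (fun n => u (φ n)) w atTop (Ioc 0 T) := by
  have hN1 : ∀ n, 1 ≤ N n := fun n => Nat.one_le_iff_ne_zero.2 fun h0 => by
    simp [hN n, h0] at hT
  -- Nothing is known about `u n 0`: it is replaced by the value on the first step.
  set f : ℕ → Icc 0 T → F := fun n t => u n (max t (τ n))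
  have hfu : ∀ n (t : Icc 0 T), 0 < (t : ℝ) → f n t = u n t := fun n _ =>
    (hu n).apply_max_eq (hN1 n)
  have hequi : AsymptoticallyUniformEquicontinuous f atTop := by
    refine asymptoticallyUniformEquicontinuous_of_edist_le (η := fun n => 2 * τ n)
      (by simpa using hlim.const_mul 2) hC (e := 1 - 1 / r.toReal) ?_ fun n s t => ?_
    · rcases eq_or_ne r ∞ with rfl | hr'
      · simp
      · have : 1 < r.toReal := by simpa using (ENNReal.toReal_lt_toReal (by simp) hr').2 hr
        exact sub_pos.2 ((div_lt_one (by linarith)).2 this)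
    · have hτT : τ n ≤ T := by
        rw [hN n]; exact le_mul_of_one_le_left (hτ n).le (mod_cast hN1 n)
      have hmem : ∀ s : Icc 0 T, max (s : ℝ) (τ n) ∈ Ioc 0 (N n * τ n) := fun s =>
        ⟨lt_max_of_lt_right (hτ n), hN n ▸ max_le s.2.2 hτT⟩
      refine ((hu n).edist_le_of_eLpNorm_shift_le (hτ n) hr.le (hN n ▸ hshift n) (hmem s)
        (hmem t)).trans ?_
      gcongr
      · exact one_sub_one_div_toReal_nonneg hr.le
      · exact abs_max_sub_max_le_abs _ _ _
  obtain ⟨φ, hφ, w, hw, hunif⟩ := hequi.exists_subseq_tendstoUniformly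
    isCompact_univ.totallyBounded fun x V hV => .of_forall_Ioc hT hmeet hfu hV
  refine ⟨φ, hφ, IccExtend hT.le w, hw.continuous.Icc_extend'.continuousOn, fun V hV => ?_⟩
  filter_upwards [hunif V hV] with n hn t ht
  have htI : t ∈ Icc 0 T := Ioc_subset_Icc_self ht
  rw [IccExtend_of_mem hT.le w htI, ← hfu (φ n) ⟨t, htI⟩ ht.1]
  exact hn ⟨t, htI⟩

lemma IsNonlinearCompact.meetsTotallyBounded_Ioc {ι X B : Type*} [NormedAddCommGroup X]
    [NormedAddCommGroup B] {K : X → B} (hK : IsNonlinearCompact K) {T : ℝ} {τ : ι → ℝ} {N : ι → ℕ}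
    (hτ : ∀ i, 0 < τ i) (hN : ∀ i, T = N i * τ i) {v : ι → ℝ → X} {u : ι → ℝ → B}
    (hv : ∀ i, IsPiecewiseConstInTime (τ i) (N i) (v i))
    (huv : ∀ i, ∀ t ∈ Ioc 0 T, u i t = K (v i t)) {C : ℝ≥0∞} (hC : C ≠ ∞)
    (hvC : ∀ i, eLpNorm (v i) 1 (timeMeasure 0 T) ≤ C) {s t : ℝ} (hs : 0 ≤ s) (hst : s < t)
    (ht : t ≤ T) : MeetsTotallyBounded (Ioc s t) u := by
  have hsub : Ioc s t ⊆ Ioc 0 T := Ioc_subset_Ioc hs ht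
  have hμ : volume.restrict (Ioc s t) ≤ timeMeasure 0 T := by
    rw [timeMeasure_eq_restrict_Ioc]
    exact Measure.restrict_mono hsub le_rfl
  obtain ⟨A, hA, hvA⟩ := hK.meetsTotallyBounded (μ := volume) (s := Ioc s t) (v := v)
    (by simpa using hst) (by simp)
    (fun i => (hN i ▸ (hv i).aestronglyMeasurable (hτ i)).mono_measure hμ) hC
    fun i => (eLpNorm_mono_measure _ hμ).trans (hvC i)
  refine ⟨A, hA, fun i => ?_⟩
  obtain ⟨x, hx, hxA⟩ := hvA i
  exact ⟨x, hx, huv i x (hsub hx) ▸ hxA⟩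

theorem mainTheorem5_general {X B : Type*} [NormedAddCommGroup X] [NormedAddCommGroup B]
    [CompleteSpace B] (p r : ℝ≥0∞) [Fact (1 ≤ p)] (hr : 1 ≤ r) (T : ℝ) (hT : 0 < T)
    (K : X → B) (hK : IsNonlinearCompact K)
    (τ : ℕ → ℝ) (N : ℕ → ℕ) (hτ : ∀ n, 0 < τ n) (hN : ∀ n, T = (N n : ℝ) * τ n)
    (v : ℕ → ℝ → X) (u : ℕ → ℝ → B)
    (hvconst : ∀ n, IsPiecewiseConstInTime (τ n) (N n) (v n))
    (huv : ∀ n, ∀ t ∈ Ioc 0 T, u n t = K (v n t))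
    (hu : ∀ n, MemLp (u n) p (timeMeasure 0 T))
    (hvbdd : ∃ C : ℝ, ∀ n, eLpNorm (v n) 1 (timeMeasure 0 T) ≤ ENNReal.ofReal C)
    (hshift : ∃ C : ℝ, ∀ n,
      eLpNorm (fun t => u n (t + τ n) - u n t) r (timeMeasure 0 (T - τ n))
        ≤ ENNReal.ofReal (C * τ n)) :
    (p < ∞ → IsCompact (closure (range fun n => (hu n).toLp (u n)))) ∧
    (1 < r → Tendsto τ atTop (𝓝 0) →
      ∃ φ : ℕ → ℕ, StrictMono φ ∧ ∃ w : ℝ → B, ContinuousOn w (Icc 0 T) ∧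
        TendstoUniformlyOn (fun n => u (φ n)) w atTop (Ioc 0 T)) := by
  obtain ⟨A, hA⟩ := hvbdd
  obtain ⟨C, hC⟩ := hshift
  replace hC := fun n => (hC n).trans_eq (ENNReal.ofReal_mul' (hτ n).le)
  have huconst : ∀ n, IsPiecewiseConstInTime (τ n) (N n) (u n) := fun n =>
    ((hvconst n).comp K).congr (hτ n).le (hN n ▸ fun t ht => (huv n t ht).symm)
  have hmeet : ∀ s t, 0 ≤ s → s < t → t ≤ T → MeetsTotallyBounded (Ioc s t) u :=
    fun s t hs hst ht => hK.meetsTotallyBounded_Ioc hτ hN hvconst huv ENNReal.ofReal_ne_top hA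
      hs hst ht
  refine ⟨fun hp => ?_, fun hr' hlim => exists_subseq_tendstoUniformlyOn_of_eLpNorm_shift_le hT hτ
    hN hlim huconst hr' ENNReal.ofReal_ne_top hC hmeet⟩
  have hvar : ∀ n, eVariationOn (u n) (Ioc 0 T) ≤
      ENNReal.ofReal C * ENNReal.ofReal T ^ (1 - 1 / r.toReal) := fun n => by
    simpa [← hN n] using (huconst n).eVariationOn_Ioc_le_of_eLpNorm_shift_le (hτ n) hr
      (hN n ▸ hC n) (N n).zero_le le_rfl
  have hfinite : ENNReal.ofReal C * ENNReal.ofReal T ^ (1 - 1 / r.toReal) ≠ ∞ :=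
    ENNReal.mul_ne_top ENNReal.ofReal_ne_top (ENNReal.rpow_ne_top_of_nonneg
      (one_sub_one_div_toReal_nonneg hr) ENNReal.ofReal_ne_top)
  exact (totallyBounded_range_toLp_of_eVariationOn_le hp.ne hT hu hfinite hvar
    hmeet).closure.isCompact_of_isClosed isClosed_closure

theorem mainTheorem5
    {X B : Type*} [NormedAddCommGroup X] [NormedSpace ℝ X] [CompleteSpace X]
    [NormedAddCommGroup B] [NormedSpace ℝ B] [CompleteSpace B]
    (p r : ℝ≥0∞) [Fact (1 ≤ p)]
    (hpr : (p < ∞ ∧ r = 1) ∨ (p = ∞ ∧ 1 < r))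
    (T : ℝ) (hT : 0 < T)
    (K : X → B) (hK : IsNonlinearCompact K)
    (τ : ℕ → ℝ) (N : ℕ → ℕ) (hτ : ∀ n, 0 < τ n) (hN : ∀ n, T = (N n : ℝ) * τ n)
    (v : ℕ → ℝ → X) (u : ℕ → ℝ → B)
    (hv : ∀ n, MemLp (v n) 1 (timeMeasure 0 T))
    (hvconst : ∀ n, IsPiecewiseConstInTime (τ n) (N n) (v n))
    (huv : ∀ n, ∀ t ∈ Ioc 0 T, u n t = K (v n t))
    (hu : ∀ n, MemLp (u n) p (timeMeasure 0 T))
    (hvbdd : ∃ C : ℝ, ∀ n, eLpNorm (v n) 1 (timeMeasure 0 T) ≤ ENNReal.ofReal C)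
    (hubdd : ∃ C : ℝ, ∀ n, eLpNorm (u n) 1 (timeMeasure 0 T) ≤ ENNReal.ofReal C)
    (hshift : ∃ C : ℝ, 0 < C ∧ ∀ n,
      eLpNorm (fun t => u n (t + τ n) - u n t) r (timeMeasure 0 (T - τ n))
        ≤ ENNReal.ofReal (C * τ n)) :
    (p < ∞ →
      IsCompact (closure (Set.range fun n : ℕ =>
        ((hu n).toLp (u n) : Lp B p (timeMeasure 0 T))))) ∧
    (p = ∞ → Tendsto τ atTop (𝓝 0) →
      ∃ φ : ℕ → ℕ, StrictMono φ ∧ ∃ w : ℝ → B, ContinuousOn w (Icc 0 T) ∧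
        ∀ q : ℝ≥0∞, 1 ≤ q → q < ∞ →
          Tendsto (fun n => eLpNorm (fun t => u (φ n) t - w t) q (timeMeasure 0 T))
            atTop (𝓝 0)) := by
  obtain ⟨hcompact, hunif⟩ := mainTheorem5_general p r
    (hpr.elim (fun h => h.2.ge) fun h => h.2.le) T hT K hK τ N hτ hN v u hvconst huv hu hvbdd
    (hshift.imp fun _ h => h.2)
  refine ⟨hcompact, fun hp hlim => ?_⟩
  have hr : 1 < r := (hpr.resolve_left fun h => h.1.ne hp).2
  obtain ⟨φ, hφ, w, hw, huw⟩ := hunif hr hlim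
  exact ⟨φ, hφ, w, hw, fun q _ _ => tendsto_eLpNorm_of_tendstoUniformlyOn_Ioc huw q⟩
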